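/- Let $n \ge 0$ be an integer and let $S_n$ be the symmetric group on $\{1,\dots,n\}$ with generators the adjacent transpositions $s_i=(i,i+1)$, $1\le i\le n-1$, and let $\ell$ be the corresponding length function ($\ell(w)$ is the minimal length of a word for $w$ in the $s_i$). For $w,w'\in S_n$ write $w\to w'$ if there is a finite (possibly trivial) sequence $w=w_1,\dots,w_{k+1}=w'$ such that for each $j$ there is some $i$ with $w_{j+1}=s_iw_js_i$ and $\ell(w_{j+1})\le\ell(w_j)$; write $w\approx w'$ if $w\to w'$ and $w'\to w$. Let $(S_n)_{\max}$ be the set of elements whose length is maximal within their conjugacy class in $S_n$, and let $(S_n)_{\max}/{\approx}$ be the set of $\approx$-equivalence classes of such elements. A composition $\alpha=(\alpha_1,\dots,\alpha_l)$ of $n$ (a finite sequence of positive integers with sum $n$) is called maximal if there is $0\le k\le l$ such that $\alpha_i$ is even for $i\le k$, $\alpha_i$ is odd for $i>k$, and $\alpha_{k+1}\ge\alpha_{k+2}\ge\dots\ge\alpha_l$. Define the sequence $(x_1,\dots,x_n)$ by $x_{2i-1}:=i$ and $x_{2i}:=n-i+1$. The element in stair form $\sigma_\alpha\in S_n$ is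 the product of the disjoint cycles $$\bigl(x_{d_{i-1}+1},\,x_{d_{i-1}+2},\,\dots,\,x_{d_i}\bigr),\qquad d_i=\alpha_1+\dots+\alpha_i,\quad i=1,\dots,l.$$ Theorem. For every maximal composition $\alpha$ of $n$ one has $\sigma_\alpha\in(S_n)_{\max}$, and the map sending $\alpha$ to the $\approx$-class $\Sigma_\alpha$ of $\sigma_\alpha$ is a bijection from the set of maximal compositions of $n$ onto $(S_n)_{\max}/{\approx}$. In particular, $\{\sigma_\alpha : \alpha \text{ a maximal composition of } n\}$ is a complete set of representatives of $(S_n)_{\max}/{\approx}$: every class contains exactly one of these elements. -/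

import Mathlib

open Equiv

/-- The Coxeter generators of the symmetric group on `Fin n` (which plays the role of
`{1, …, n}`, with labels shifted by one): the adjacent transpositions `(i, i + 1)`. -/
def adjacentTranspositions (n : ℕ) : Set (Perm (Fin n)) :=
  {s | ∃ (i : ℕ) (h : i + 1 < n), s = swap ⟨i, Nat.lt_of_succ_lt h⟩ ⟨i + 1, h⟩}

/-- `IsWord l w`: the list `l` of adjacent transpositions is a word for `w`. -/
def IsWord {n : ℕ} (l : List (Perm (Fin n))) (w : Perm (Fin n)) : Prop :=
  (∀ s ∈ l, s ∈ adjacentTranspositions n) ∧ l.prod = w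

/-- Every permutation has a word, so the infimum in `coxeterLength` is a minimum. -/
theorem exists_isWord {n : ℕ} (w : Perm (Fin n)) : ∃ l, IsWord l w := by
  cases n with
  | zero => exact ⟨[], by simp, Subsingleton.elim _ _⟩
  | succ n =>
    have hw : w ∈ Submonoid.closure
        (Set.range fun i : Fin n => swap i.castSucc i.succ) := by
      rw [Perm.mclosure_swap_castSucc_succ]; trivial
    obtain ⟨l, hl, hp⟩ := Submonoid.exists_list_of_mem_closure hw
    refine ⟨l, fun s hs => ?_, hp⟩
    obtain ⟨i, rfl⟩ := hl s hs
    exact ⟨i, Nat.succ_lt_succ i.2, rfl⟩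

/-- The Coxeter length: the minimal length of a word in the adjacent transpositions. -/
noncomputable def coxeterLength {n : ℕ} (w : Perm (Fin n)) : ℕ :=
  sInf {k | ∃ l, IsWord l w ∧ l.length = k}

/-- The elements whose length is maximal in their conjugacy class. -/
def maxLengthElements (n : ℕ) : Set (Perm (Fin n)) :=
  {w | ∀ w', IsConj w w' → coxeterLength w' ≤ coxeterLength w}

/-- An elementary cyclic shift: `w' = s w s` for an adjacent transposition `s`,
and the length does not increase. -/
def CyclicShiftStep {n : ℕ} (w w' : Perm (Fin n)) : Prop :=
  ∃ s ∈ adjacentTranspositions n, w' = s * w * s ∧ coxeterLength w' ≤ coxeterLength w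

/-- The cyclic shift relation `w → w'`. -/
def CyclicShift {n : ℕ} : Perm (Fin n) → Perm (Fin n) → Prop :=
  Relation.ReflTransGen CyclicShiftStep

/-- The relation `w ≈ w'`: both `w → w'` and `w' → w`. -/
def CyclicShiftEquiv {n : ℕ} (w w' : Perm (Fin n)) : Prop :=
  CyclicShift w w' ∧ CyclicShift w' w

theorem cyclicShiftEquiv_equivalence (n : ℕ) :
    Equivalence (CyclicShiftEquiv : Perm (Fin n) → Perm (Fin n) → Prop) where
  refl _ := ⟨Relation.ReflTransGen.refl, Relation.ReflTransGen.refl⟩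
  symm h := ⟨h.2, h.1⟩
  trans h k := ⟨Relation.ReflTransGen.trans h.1 k.1, Relation.ReflTransGen.trans k.2 h.2⟩

/-- The relation `≈` on the elements of maximal length in their conjugacy class. -/
def maxSetoid (n : ℕ) : Setoid (maxLengthElements n) where
  r w w' := CyclicShiftEquiv w.1 w'.1
  iseqv :=
    { refl := fun w => (cyclicShiftEquiv_equivalence n).refl w.1
      symm := fun h => (cyclicShiftEquiv_equivalence n).symm h
      trans := fun h k => (cyclicShiftEquiv_equivalence n).trans h k }

/-- The set of cyclic shift classes of elements of maximal length in their conjugacy class. -/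
abbrev MaxCyclicShiftClasses (n : ℕ) : Type := Quotient (maxSetoid n)

/-- A composition is maximal if its first `k` parts are even, for some `k`, and its remaining
parts are odd and weakly decreasing. -/
def IsMaximalComposition {n : ℕ} (α : Composition n) : Prop :=
  ∃ k ≤ α.length,
    (∀ i : Fin α.length, (i : ℕ) < k → Even (α.blocksFun i)) ∧
    (∀ i : Fin α.length, k ≤ (i : ℕ) → Odd (α.blocksFun i)) ∧
    (∀ i j : Fin α.length, k ≤ (i : ℕ) → i ≤ j → α.blocksFun j ≤ α.blocksFun i)

/-- The sequence `1, n, 2, n - 1, …` with positions and values both shifted by one: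
`0, n - 1, 1, n - 2, …`. -/
def stairSeq (n : ℕ) (k : Fin n) : Fin n :=
  if (k : ℕ) % 2 = 0 then ⟨k / 2, by omega⟩ else ⟨n - 1 - k / 2, by omega⟩

/-- The cycle whose entries, in order, form the `i`-th of the consecutive sublists into which
`α` cuts the sequence `stairSeq n`. -/
def stairCycle {n : ℕ} (α : Composition n) (i : Fin α.length) : Perm (Fin n) :=
  (List.ofFn fun j : Fin (α.blocksFun i) => stairSeq n (α.embedding i j)).formPerm

/-- The element in stair form corresponding to `α`. -/
def stairForm {n : ℕ} (α : Composition n) : Perm (Fin n) :=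
  (List.ofFn fun i : Fin α.length => stairCycle α i).prod

/-!
The Coxeter length of a permutation is its number of inversions (`coxeterLength_eq`), so the
theorem is about the ways in which conjugation by an adjacent transposition changes inversions.
Write `x` for the stair sequence. It lists the points from the outside inwards: `x_k` is smaller
than all later entries if `k` is even (counting from zero) and larger than all of them if `k` is
odd (`stairSeq_lt_iff`).

*Every class meets the elements in stair form* (`exists_cyclicShift_stairForm`). Suppose `w` is
already in stair form on `x_0, …, x_(k-1)`. Either the image of `x_k` closes the current cycle, or
it is one of the remaining points `x_(k+1), x_(k+2), …`. These form an interval whose end opposite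
to `x_k` is `x_(k+1)`, and the image can be moved to that end by conjugations with adjacent
transpositions of the interval. None of them decreases the length, because `x_k` lies outside the
interval and the preimages of the other points of the interval are remaining entries as well, which
all lie on the same side of `x_k`. So every permutation arises by cyclic shifts from some
`stairForm α`, where `α` need not be maximal.

*Which stair forms are longest.* The non-inversions of `stairForm α` can be counted: a block of
length `p` contributes `(p - 1) / 2` on its own, and if `p` is odd, the last entry of the block
forms a non-inversion with every later entry (`card_inversions_stairForm_add`). Only the second
contribution, `oddCost`, depends on the order of the blocks. It is minimal exactly if all even
blocks come first and the odd ones decrease weakly, that is, if `α` is maximal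
(`oddCost_le_minCost_iff`, `isMaximalComposition_iff`). Since two elements in stair form are
conjugate if and only if their blocks agree up to order (`isConj_stairForm_iff`), the elements
`stairForm α` with `α` maximal have maximal length and represent all classes.

*Distinct maximal compositions give distinct classes* (`eq_of_cyclicShiftEquiv_stairForm`). The
property that `w` exchanges the first `j` points with the last `j` points is invariant under
length-preserving shifts: a transposition that could destroy it is a descent of `w` on both sides,
and conjugation by such a transposition shortens `w` or fixes it (`swap_conj_eq_self`). For
`stairForm α` with `α` maximal, the numbers `2 j` with this property are the partial sums of the
leading even blocks. These blocks are therefore determined with their order, while the odd ones are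
determined by the cycle type (`eq_of_flipsParity_iff`).
-/

section

variable {n : ℕ}

/-! ### Coxeter length and inversions -/


/-- The inversions of `w`: the pairs of positions `a < b` with `w b < w a`. -/
def inversions (w : Perm (Fin n)) : Finset (Fin n × Fin n) :=
  Finset.univ.filter fun p => p.1 < p.2 ∧ w p.2 < w p.1

theorem mem_inversions {w : Perm (Fin n)} {a b : Fin n} :
    (a, b) ∈ inversions w ↔ a < b ∧ w b < w a := by
  simp [inversions]

/-- An adjacent transposition changes the relative order of no pair but its own. -/
theorem swap_lt_swap_iff {i j : Fin n} (hij : (j : ℕ) = i + 1) {a b : Fin n}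
    (h : ¬(a = i ∧ b = j)) (h' : ¬(a = j ∧ b = i)) :
    swap i j a < swap i j b ↔ a < b := by
  simp only [swap_apply_def]
  split_ifs <;> simp only [Fin.lt_def, Fin.ext_iff] at * <;> omega

theorem card_inversions_mul_swap {i j : Fin n} (hij : (j : ℕ) = i + 1) {w : Perm (Fin n)}
    (h : w i < w j) : (inversions (w * swap i j)).card = (inversions w).card + 1 := by
  have hlt : i < j := by rw [Fin.lt_def]; omega
  have key : inversions (w * swap i j) =
      insert (i, j) ((inversions w).map ((swap i j).prodCongr (swap i j)).toEmbedding) := by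
    ext ⟨a, b⟩
    rw [Finset.mem_insert, Finset.mem_map_equiv]
    simp only [prodCongr_symm, symm_swap, prodCongr_apply, Prod.map_apply, mem_inversions,
      Perm.mul_apply, Prod.mk.injEq]
    by_cases h1 : a = i ∧ b = j
    · obtain ⟨rfl, rfl⟩ := h1
      simp [hlt, h]
    · by_cases h2 : a = j ∧ b = i
      · obtain ⟨rfl, rfl⟩ := h2
        simp [hlt, h.le, hlt.ne]
      · rw [swap_lt_swap_iff hij h1 h2]
        simp [h1]
  rw [key, Finset.card_insert_of_notMem, Finset.card_map]
  rw [Finset.mem_map_equiv]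
  simp [mem_inversions, hlt.le]

theorem card_inversions_inv (w : Perm (Fin n)) :
    (inversions w⁻¹).card = (inversions w).card := by
  refine Finset.card_nbij' (fun p => (w⁻¹ p.2, w⁻¹ p.1)) (fun p => (w p.2, w p.1)) ?_ ?_ ?_ ?_ <;>
    rintro ⟨a, b⟩ <;> simp [mem_inversions, and_comm]

theorem card_inversions_swap_mul {i j : Fin n} (hij : (j : ℕ) = i + 1) {w : Perm (Fin n)}
    (h : w⁻¹ i < w⁻¹ j) : (inversions (swap i j * w)).card = (inversions w).card + 1 := by
  rw [← card_inversions_inv, mul_inv_rev, swap_inv, card_inversions_mul_swap hij h,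
    card_inversions_inv]

theorem mul_swap_ascent {i j : Fin n} {w : Perm (Fin n)} (h : w j < w i) :
    (w * swap i j) i < (w * swap i j) j := by
  simpa using h

theorem card_inversions_mul_swap_of_gt {i j : Fin n} (hij : (j : ℕ) = i + 1) {w : Perm (Fin n)}
    (h : w j < w i) : (inversions w).card = (inversions (w * swap i j)).card + 1 := by
  have := card_inversions_mul_swap hij (mul_swap_ascent h)
  rwa [mul_assoc, swap_mul_self, mul_one] at this

theorem card_inversions_mul_swap_le {i j : Fin n} (hij : (j : ℕ) = i + 1) (w : Perm (Fin n)) :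
    (inversions (w * swap i j)).card ≤ (inversions w).card + 1 ∧
      (inversions w).card ≤ (inversions (w * swap i j)).card + 1 := by
  have hne : i ≠ j := by rw [Ne, Fin.ext_iff]; omega
  rcases lt_or_gt_of_ne (w.injective.ne hne) with h | h
  · have := card_inversions_mul_swap hij h
    omega
  · have := card_inversions_mul_swap_of_gt hij h
    omega

theorem eq_one_of_forall_ascent {w : Perm (Fin n)}
    (h : ∀ i j : Fin n, (j : ℕ) = i + 1 → w i < w j) : w = 1 := by
  have hw : StrictMono w := by
    cases n with
    | zero => exact fun a => a.elim0
    | succ n => exact Fin.strictMono_iff_lt_succ.2 fun i => h _ _ (by simp)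
  ext a
  have := (Subsingleton.elim (hw.orderIsoOfSurjective w w.surjective) (OrderIso.refl _))
  simpa using congrArg Fin.val (DFunLike.congr_fun this a)

theorem inversions_one : inversions (1 : Perm (Fin n)) = ∅ := by
  rw [inversions, Finset.filter_eq_empty_iff]
  rintro ⟨a, b⟩ - ⟨h1, h2⟩
  exact lt_asymm h1 h2

theorem exists_isWord_length (w : Perm (Fin n)) :
    ∃ l, IsWord l w ∧ l.length = (inversions w).card := by
  induction hk : (inversions w).card generalizing w with
  | zero =>
    refine ⟨[], ⟨by simp, ?_⟩, rfl⟩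
    refine (eq_one_of_forall_ascent fun i j hij => ?_).symm
    have hne : i ≠ j := by rw [Ne, Fin.ext_iff]; omega
    by_contra hlt
    have := card_inversions_mul_swap_of_gt hij
      (lt_of_le_of_ne (not_lt.1 hlt) (w.injective.ne hne.symm))
    omega
  | succ k ih =>
    have : ∃ i j : Fin n, (j : ℕ) = i + 1 ∧ w j < w i := by
      by_contra! hc
      have hw : w = 1 := eq_one_of_forall_ascent fun i j hij =>
        lt_of_le_of_ne (hc i j hij) (w.injective.ne (by rw [Ne, Fin.ext_iff]; omega))
      simp [hw, inversions_one] at hk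
    obtain ⟨i, j, hij, h⟩ := this
    obtain ⟨l, ⟨hl, hp⟩, hlen⟩ := ih (w * swap i j)
      (by have := card_inversions_mul_swap_of_gt hij h; omega)
    refine ⟨l ++ [swap i j], ⟨fun s hs => ?_, ?_⟩, by simp [hlen]⟩
    · rcases List.mem_append.1 hs with hs | hs
      · exact hl s hs
      · rw [List.mem_singleton.1 hs]
        refine ⟨i, by omega, ?_⟩
        congr 1
        exact Fin.ext hij
    · rw [List.prod_append, hp, List.prod_singleton, mul_assoc, swap_mul_self, mul_one]

theorem exists_eq_swap {s : Perm (Fin n)} (hs : s ∈ adjacentTranspositions n) :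
    ∃ i j : Fin n, (j : ℕ) = i + 1 ∧ s = swap i j := by
  obtain ⟨i, h, rfl⟩ := hs
  exact ⟨_, _, rfl, rfl⟩

theorem swap_mem_adjacentTranspositions {i j : Fin n} (hij : (j : ℕ) = i + 1) :
    swap i j ∈ adjacentTranspositions n := by
  refine ⟨i, by omega, ?_⟩
  congr 1
  exact Fin.ext hij

theorem card_inversions_le_length {l : List (Perm (Fin n))} :
    ∀ {w : Perm (Fin n)}, IsWord l w → (inversions w).card ≤ l.length := by
  induction l using List.reverseRecOn with
  | nil =>
    rintro w ⟨-, rfl⟩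
    simp [inversions_one]
  | append_singleton l s ih =>
    rintro w ⟨hl, rfl⟩
    obtain ⟨i, j, hij, rfl⟩ := exists_eq_swap (hl s (by simp))
    have h1 := ih ⟨fun s hs => hl s (by simp [hs]), rfl⟩
    have h2 := card_inversions_mul_swap_le hij l.prod
    simp only [List.prod_append, List.prod_singleton, List.length_append, List.length_singleton]
    omega

theorem coxeterLength_eq (w : Perm (Fin n)) : coxeterLength w = (inversions w).card := by
  refine le_antisymm (Nat.sInf_le (exists_isWord_length w)) ?_
  obtain ⟨l, hl, hk⟩ := Nat.sInf_mem (s := {k | ∃ l, IsWord l w ∧ l.length = k})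
    ⟨_, exists_isWord_length w⟩
  exact (card_inversions_le_length hl).trans_eq hk

/-! ### Cutting an interval into cycles -/

/-- The successor of position `k` when the interval of positions that starts at `b` is cut into
consecutive blocks of lengths `L` and every block is rotated cyclically: the next position in the
same block, or the first position of the block if `k` is its last one. Positions past the last
block are fixed. -/
def stairNext : List ℕ → ℕ → ℕ → ℕ
  | [], _, k => k
  | p :: L, b, k =>
    if k + 1 < b + p then k + 1 else if k + 1 = b + p then b else stairNext L (b + p) k

theorem stairNext_cons_of_lt {p b k : ℕ} (L : List ℕ) (h : k + 1 < b + p) :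
    stairNext (p :: L) b k = k + 1 := by simp [stairNext, h]

theorem stairNext_cons_of_eq {p b k : ℕ} (L : List ℕ) (h : k + 1 = b + p) :
    stairNext (p :: L) b k = b := by simp [stairNext, h]

theorem stairNext_cons_of_le {p b k : ℕ} (L : List ℕ) (h : b + p ≤ k) :
    stairNext (p :: L) b k = stairNext L (b + p) k := by
  simp [stairNext, show ¬ k + 1 < b + p by omega, show ¬ k + 1 = b + p by omega]

theorem stairNext_bounds {L : List ℕ} (hL : ∀ p ∈ L, 0 < p) {b k : ℕ} (h1 : b ≤ k)
    (h2 : k < b + L.sum) : b ≤ stairNext L b k ∧ stairNext L b k < b + L.sum := by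
  induction L generalizing b with
  | nil => simp at h2; omega
  | cons p L ih =>
    have hp := hL p (by simp)
    simp only [List.sum_cons] at h2 ⊢
    rcases lt_trichotomy (k + 1) (b + p) with h | h | h
    · rw [stairNext_cons_of_lt L h]; omega
    · rw [stairNext_cons_of_eq L h]; omega
    · rw [stairNext_cons_of_le L (by omega)]
      have := ih (fun q hq => hL q (by simp [hq])) (b := b + p) (by omega) (by omega)
      omega

theorem stairNext_append_left {L : List ℕ} (L' : List ℕ) {b k : ℕ}
    (h1 : b ≤ k) (h2 : k < b + L.sum) : stairNext (L ++ L') b k = stairNext L b k := by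
  induction L generalizing b with
  | nil => simp at h2; omega
  | cons p L ih =>
    simp only [List.sum_cons, List.cons_append] at h2 ⊢
    rcases lt_trichotomy (k + 1) (b + p) with h | h | h
    · rw [stairNext_cons_of_lt _ h, stairNext_cons_of_lt _ h]
    · rw [stairNext_cons_of_eq _ h, stairNext_cons_of_eq _ h]
    · rw [stairNext_cons_of_le _ (by omega), stairNext_cons_of_le _ (by omega)]
      exact ih (by omega) (by omega)

theorem stairNext_append_right {L : List ℕ} (L' : List ℕ) {b k : ℕ}
    (h : b + L.sum ≤ k) : stairNext (L ++ L') b k = stairNext L' (b + L.sum) k := by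
  induction L generalizing b with
  | nil => simp
  | cons p L ih =>
    simp only [List.sum_cons, List.cons_append] at h ⊢
    rw [stairNext_cons_of_le _ (by omega), ih (by omega)]
    congr 1
    omega

theorem stairNext_getElem {L : List ℕ} {b i j : ℕ} (hi : i < L.length) (hj : j < L[i]) :
    stairNext L b (b + (L.take i).sum + j) = b + (L.take i).sum + (j + 1) % L[i] := by
  have key : stairNext (L.take i ++ L[i] :: L.drop (i + 1)) b (b + (L.take i).sum + j) =
      b + (L.take i).sum + (j + 1) % L[i] := by
    rw [stairNext_append_right _ (by omega)]
    rcases Nat.lt_or_ge (j + 1) L[i] with h | h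
    · rw [stairNext_cons_of_lt _ (by omega), Nat.mod_eq_of_lt h]
      omega
    · rw [stairNext_cons_of_eq _ (by omega), show j + 1 = L[i] by omega, Nat.mod_self]
      omega
  simpa using key

/-! ### Counting non-inversions -/

/-- The order of the values of the stair sequence, read off from their positions: an entry in an
even position is smaller than all later entries, one in an odd position is larger. -/
def StairLt (i j : ℕ) : Prop := (i < j ∧ i % 2 = 0) ∨ (j < i ∧ j % 2 = 1)

instance : DecidableRel StairLt := fun i j => by unfold StairLt; infer_instance

/-- For positions `k < l`: the permutation `x_i ↦ x_(stairNext L b i)` of the values of the stair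
sequence `x` keeps the order of `x_k` and `x_l`. -/
def KeepsOrder (L : List ℕ) (b k l : ℕ) : Prop :=
  k % 2 = 0 ↔ StairLt (stairNext L b k) (stairNext L b l)

instance (L : List ℕ) (b : ℕ) : DecidableRel (KeepsOrder L b) :=
  fun i j => by unfold KeepsOrder; infer_instance

/-- The part of the number of non-inversions that depends on the order of the blocks: the last
entry of a block of odd length forms a non-inversion with every later entry. -/
def oddCost : List ℕ → ℕ
  | [] => 0
  | p :: L => (if p % 2 = 1 then L.sum else 0) + oddCost L

theorem sum_range_mod_two (m : ℕ) : ∑ j ∈ Finset.range m, j % 2 = m / 2 := by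
  induction m with
  | zero => rfl
  | succ m ih => rw [Finset.sum_range_succ, ih]; omega

/-- An entry which is not the last one of its block forms at most one non-inversion with a later
entry, namely with the last entry of its block. -/
theorem sum_keepsOrder_of_lt {p : ℕ} {L : List ℕ} (hL : ∀ q ∈ L, 0 < q) {b k : ℕ} (h1 : b ≤ k)
    (h2 : k + 1 < b + p) :
    (∑ l ∈ Finset.Ico (k + 1) (b + (p + L.sum)), if KeepsOrder (p :: L) b k l then 1 else 0) =
      (k - b) % 2 := by
  rw [Finset.sum_eq_single (b + p - 1)]
  · simp only [KeepsOrder, StairLt, stairNext_cons_of_lt L h2,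
      stairNext_cons_of_eq L (show b + p - 1 + 1 = b + p by omega)]
    split_ifs <;> omega
  · intro l hl hne
    rw [Finset.mem_Ico] at hl
    have : k + 1 < stairNext (p :: L) b l := by
      rcases Nat.lt_or_ge (l + 1) (b + p) with h | h
      · rw [stairNext_cons_of_lt L h]; omega
      · rw [stairNext_cons_of_le L (by omega)]
        have := stairNext_bounds hL (b := b + p) (k := l) (by omega) (by omega)
        omega
    rw [if_neg]
    simp only [KeepsOrder, StairLt, stairNext_cons_of_lt L h2]
    omega
  · intro h
    rw [Finset.mem_Ico] at h
    omega

/-- The last entry of a block of odd length forms a non-inversion with every later entry, the last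
entry of a block of even length with none. -/
theorem sum_keepsOrder_of_eq {p : ℕ} {L : List ℕ} (hL : ∀ q ∈ L, 0 < q) {b k : ℕ} (hp : 0 < p)
    (h2 : k + 1 = b + p) :
    (∑ l ∈ Finset.Ico (k + 1) (b + (p + L.sum)), if KeepsOrder (p :: L) b k l then 1 else 0) =
      if p % 2 = 1 then L.sum else 0 := by
  have key : ∀ l ∈ Finset.Ico (k + 1) (b + (p + L.sum)),
      (if KeepsOrder (p :: L) b k l then 1 else 0) = if p % 2 = 1 then 1 else 0 := by
    intro l hl
    rw [Finset.mem_Ico] at hl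
    have := stairNext_bounds hL (b := b + p) (k := l) (by omega) (by omega)
    simp only [KeepsOrder, StairLt, stairNext_cons_of_eq L h2,
      stairNext_cons_of_le L (show b + p ≤ l by omega)]
    split_ifs <;> omega
  rw [Finset.sum_congr rfl key, Finset.sum_const, Nat.card_Ico, smul_eq_mul]
  split_ifs <;> omega

theorem sum_keepsOrder {L : List ℕ} (hL : ∀ q ∈ L, 0 < q) (b : ℕ) :
    (∑ k ∈ Finset.Ico b (b + L.sum), ∑ l ∈ Finset.Ico (k + 1) (b + L.sum),
      if KeepsOrder L b k l then 1 else 0) = (L.map fun p => (p - 1) / 2).sum + oddCost L := by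
  induction L generalizing b with
  | nil => simp [oddCost]
  | cons p L ih =>
    have hp := hL p (by simp)
    have hL' : ∀ q ∈ L, 0 < q := fun q hq => hL q (by simp [hq])
    obtain ⟨e, rfl⟩ : ∃ e, p = e + 1 := ⟨p - 1, by omega⟩
    simp only [List.sum_cons, List.map_cons, oddCost]
    rw [← Finset.sum_Ico_consecutive _ (show b ≤ b + (e + 1) by omega)
      (show b + (e + 1) ≤ b + (e + 1 + L.sum) by omega),
      show b + (e + 1) = (b + e) + 1 by omega, Finset.sum_Ico_succ_top (by omega),
      sum_keepsOrder_of_eq hL' hp (by omega)]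
    have h1 : ∀ k ∈ Finset.Ico b (b + e), (∑ l ∈ Finset.Ico (k + 1) (b + (e + 1 + L.sum)),
        if KeepsOrder ((e + 1) :: L) b k l then 1 else 0) = (k - b) % 2 := by
      intro k hk
      rw [Finset.mem_Ico] at hk
      exact sum_keepsOrder_of_lt hL' hk.1 (by omega)
    have h2 := ih hL' (b + e + 1)
    rw [show b + e + 1 + L.sum = b + (e + 1 + L.sum) by omega] at h2
    have h3 : ∀ k ∈ Finset.Ico (b + e + 1) (b + (e + 1 + L.sum)),
        (∑ l ∈ Finset.Ico (k + 1) (b + (e + 1 + L.sum)),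
          if KeepsOrder ((e + 1) :: L) b k l then 1 else 0) =
        ∑ l ∈ Finset.Ico (k + 1) (b + (e + 1 + L.sum)),
          if KeepsOrder L (b + e + 1) k l then 1 else 0 := by
      intro k hk
      refine Finset.sum_congr rfl fun l hl => ?_
      rw [Finset.mem_Ico] at hk hl
      simp only [KeepsOrder, stairNext_cons_of_le L (show b + (e + 1) ≤ k by omega),
        stairNext_cons_of_le L (show b + (e + 1) ≤ l by omega), add_assoc]
    rw [Finset.sum_congr rfl h1, Finset.sum_congr rfl h3, h2, Finset.sum_Ico_eq_sum_range]
    simp only [Nat.add_sub_cancel_left, sum_range_mod_two, Nat.add_sub_cancel]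
    omega

/-! ### The optimal order of the blocks -/

/-- The relation between an earlier part `p` and a later part `q` of a maximal composition. -/
def StairOrder (p q : ℕ) : Prop := Even p ∨ Odd q ∧ q ≤ p

/-- The least possible contribution of two blocks of lengths `p` and `q` to `oddCost`. -/
def pairMin (p q : ℕ) : ℕ := if p % 2 = 1 ∧ q % 2 = 1 then min p q else 0

/-- The sum of `pairMin` over all pairs of blocks, a lower bound for `oddCost` which does not depend
on the order of the blocks. -/
def minCost : List ℕ → ℕ
  | [] => 0
  | p :: L => (L.map (pairMin p)).sum + minCost L

theorem minCost_perm {L L' : List ℕ} (h : L.Perm L') : minCost L = minCost L' := by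
  induction h with
  | nil => rfl
  | cons p h ih => simp only [minCost, ih, (h.map _).sum_eq]
  | swap p q L =>
    have : pairMin q p = pairMin p q := by simp only [pairMin, and_comm, min_comm]
    simp only [minCost, List.map_cons, List.sum_cons, this]
    omega
  | trans _ _ ih ih' => exact ih.trans ih'

theorem sum_pairMin_le {p : ℕ} {L : List ℕ} :
    (L.map (pairMin p)).sum ≤ if p % 2 = 1 then L.sum else 0 := by
  induction L with
  | nil => simp
  | cons q L ih =>
    simp only [List.map_cons, List.sum_cons, pairMin] at ih ⊢
    split_ifs at * <;> omega

theorem le_sum_pairMin_iff {p : ℕ} {L : List ℕ} (hL : ∀ q ∈ L, 0 < q) :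
    (if p % 2 = 1 then L.sum else 0) ≤ (L.map (pairMin p)).sum ↔ ∀ q ∈ L, StairOrder p q := by
  induction L with
  | nil => simp
  | cons q L ih =>
    have hq := hL q (by simp)
    have h := sum_pairMin_le (p := p) (L := L)
    rw [List.forall_mem_cons, ← ih fun q hq => hL q (by simp [hq])]
    simp only [List.map_cons, List.sum_cons, StairOrder, Nat.even_iff, Nat.odd_iff]
    have : pairMin p q = if p % 2 = 1 ∧ q % 2 = 1 then min p q else 0 := rfl
    split_ifs at * <;> omega

theorem minCost_le_oddCost (L : List ℕ) : minCost L ≤ oddCost L := by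
  induction L with
  | nil => rfl
  | cons p L ih => exact Nat.add_le_add sum_pairMin_le ih

theorem oddCost_le_minCost_iff {L : List ℕ} (hL : ∀ q ∈ L, 0 < q) :
    oddCost L ≤ minCost L ↔ L.Pairwise StairOrder := by
  induction L with
  | nil => simp [oddCost]
  | cons p L ih =>
    have hL' : ∀ q ∈ L, 0 < q := fun q hq => hL q (by simp [hq])
    rw [List.pairwise_cons, ← ih hL', ← le_sum_pairMin_iff hL']
    have h1 := sum_pairMin_le (p := p) (L := L)
    have h2 := minCost_le_oddCost L
    simp only [oddCost, minCost]
    omega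

theorem isMaximalComposition_iff (α : Composition n) :
    IsMaximalComposition α ↔ α.blocks.Pairwise StairOrder := by
  rw [List.pairwise_iff_getElem]
  constructor
  · rintro ⟨k, -, h1, h2, h3⟩ i j hi hj hij
    rcases Nat.lt_or_ge i k with h | h
    · exact Or.inl (h1 ⟨i, hi⟩ h)
    · exact Or.inr ⟨h2 ⟨j, hj⟩ (h.trans hij.le), h3 ⟨i, hi⟩ ⟨j, hj⟩ h hij.le⟩
  · intro H
    -- `k` is the position of the first odd part, or the length if there is none.
    have hex : ∃ k, ∀ h : k < α.length, Odd (α.blocksFun ⟨k, h⟩) :=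
      ⟨α.length, fun h => absurd h (lt_irrefl _)⟩
    classical
    have hodd : ∀ i : Fin α.length, Nat.find hex ≤ i → Odd (α.blocksFun i) := by
      intro i hi
      have h := Nat.find_spec hex (hi.trans_lt i.2)
      rcases hi.eq_or_lt with e | e
      · have : i = ⟨Nat.find hex, hi.trans_lt i.2⟩ := Fin.ext e.symm
        rwa [this]
      · exact ((H _ _ (hi.trans_lt i.2) i.2 e).resolve_left
          (Nat.not_even_iff_odd.2 h)).1
    refine ⟨Nat.find hex, Nat.find_min' hex fun h => absurd h (lt_irrefl _), ?_, hodd, ?_⟩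
    · intro i hi
      have := Nat.find_min hex hi
      push Not at this
      exact Nat.not_odd_iff_even.1 this.2
    · intro i j hi hij
      rcases hij.eq_or_lt with rfl | e
      · rfl
      · exact ((H _ _ i.2 j.2 e).resolve_left (Nat.not_even_iff_odd.2 (hodd i hi))).2

/-! ### Recovering the blocks -/

/-- The successor map preserves the set of the first `m` positions after `b` and its complement, and
changes the parity of each of these `m` positions. -/
def FlipsParity (L : List ℕ) (b m : ℕ) : Prop :=
  ∀ k, b ≤ k → k < b + L.sum → (k < b + m ↔ stairNext L b k < b + m) ∧
    (k < b + m → (stairNext L b k + k) % 2 = 1)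

theorem flipsParity_cons_add {p : ℕ} (L : List ℕ) (hp : p % 2 = 0)
    (hp' : 0 < p) (b m : ℕ) : FlipsParity (p :: L) b (p + m) ↔ FlipsParity L (b + p) m := by
  simp only [FlipsParity, List.sum_cons]
  constructor
  · intro h k h1 h2
    have := h k (by omega) (by omega)
    rw [stairNext_cons_of_le L h1] at this
    omega
  · intro h k h1 h2
    rcases lt_trichotomy (k + 1) (b + p) with h' | h' | h'
    · rw [stairNext_cons_of_lt L h']; omega
    · rw [stairNext_cons_of_eq L h']; omega
    · rw [stairNext_cons_of_le L (by omega)]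
      have := h k (by omega) (by omega)
      omega

theorem flipsParity_zero {L : List ℕ} (hL : ∀ q ∈ L, 0 < q) (b : ℕ) : FlipsParity L b 0 := by
  intro k h1 h2
  have := stairNext_bounds hL h1 h2
  omega

theorem even_le_of_flipsParity {p q : ℕ} {L : List ℕ} {b : ℕ} (hp : 0 < p) (hq : 0 < q)
    (h : FlipsParity (q :: L) b p) : q % 2 = 0 ∧ q ≤ p := by
  simp only [FlipsParity, List.sum_cons] at h
  have hle : q ≤ p := by
    by_contra hlt
    have := h (b + p - 1) (by omega) (by omega)
    rw [stairNext_cons_of_lt L (by omega)] at this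
    omega
  have := h (b + q - 1) (by omega) (by omega)
  rw [stairNext_cons_of_eq L (by omega)] at this
  omega

/-- A maximal list of blocks is determined by its multiset and the set of those `m` for which the
first `m` positions change parity: these are the partial sums of the leading even blocks. -/
theorem eq_of_flipsParity_iff {L L' : List ℕ} (hL : ∀ q ∈ L, 0 < q) (hperm : L.Perm L')
    (h1 : L.Pairwise StairOrder) (h2 : L'.Pairwise StairOrder) (b : ℕ)
    (h : ∀ m, m % 2 = 0 → m ≤ L.sum → (FlipsParity L b m ↔ FlipsParity L' b m)) : L = L' := by
  induction L generalizing L' b with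
  | nil => exact hperm.nil_eq
  | cons p L ih =>
    cases L' with
    | nil => exact absurd hperm (by simp)
    | cons q L' =>
      have hL' : ∀ r ∈ q :: L', 0 < r := fun r hr => hL r (hperm.mem_iff.2 hr)
      have hp := hL p (by simp)
      have hq := hL' q (by simp)
      have hLt : ∀ r ∈ L, 0 < r := fun r hr => hL r (by simp [hr])
      have hLt' : ∀ r ∈ L', 0 < r := fun r hr => hL' r (by simp [hr])
      have hsum := hperm.sum_eq
      have hpq : p % 2 = 0 → q % 2 = 0 ∧ q ≤ p := fun hev =>
        even_le_of_flipsParity hp hq ((h p hev (by simp)).1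
          (by simpa using (flipsParity_cons_add L hev hp b 0).2 (flipsParity_zero hLt _)))
      have hqp : q % 2 = 0 → p % 2 = 0 ∧ p ≤ q := fun hev =>
        even_le_of_flipsParity hq hp ((h q hev (by rw [hsum]; simp)).2
          (by simpa using (flipsParity_cons_add L' hev hq b 0).2 (flipsParity_zero hLt' _)))
      rw [List.pairwise_cons] at h1 h2
      rcases Nat.mod_two_eq_zero_or_one p with hev | hodd
      · obtain rfl : p = q := le_antisymm (hqp (hpq hev).1).2 (hpq hev).2
        rw [ih hLt hperm.cons_inv h1.2 h2.2 (b + p)]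
        intro m hm hle
        rw [← flipsParity_cons_add L hev hp, ← flipsParity_cons_add L' hev hp]
        exact h _ (by omega) (by simpa using hle)
      · have hodd' : q % 2 = 1 := by omega
        -- Behind an odd part, a maximal list of blocks is weakly decreasing.
        have key : ∀ {r : ℕ} {T : List ℕ}, r % 2 = 1 → (∀ s ∈ T, StairOrder r s) →
            T.Pairwise StairOrder → (r :: T).Pairwise (· ≥ ·) := by
          intro r T hr hrT hT
          have hr' : ∀ s ∈ T, Odd s ∧ s ≤ r := fun s hs =>
            (hrT s hs).resolve_left (by rw [Nat.even_iff]; omega)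
          exact List.pairwise_cons.2 ⟨fun s hs => (hr' s hs).2, hT.imp_of_mem
            fun hs _ hst => (hst.resolve_left (Nat.not_even_iff_odd.2 (hr' _ hs).1)).2⟩
        exact hperm.eq_of_pairwise' (key hodd h1.1 h1.2) (key hodd' h2.1 h2.2)

/-! ### The elements in stair form -/

theorem stairSeq_lt_iff (k l : Fin n) : stairSeq n k < stairSeq n l ↔ StairLt k l := by
  have := k.2
  have := l.2
  simp only [stairSeq, StairLt, Fin.lt_def]
  split_ifs <;> dsimp only <;> omega

theorem stairSeq_injective (n : ℕ) : Function.Injective (stairSeq n) := by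
  intro k l h
  have h1 := (stairSeq_lt_iff k l).not.1 h.not_lt
  have h2 := (stairSeq_lt_iff l k).not.1 h.not_gt
  simp only [StairLt] at h1 h2
  ext
  omega

theorem stairSeq_surjective (n : ℕ) : Function.Surjective (stairSeq n) :=
  Finite.surjective_of_injective (stairSeq_injective n)

theorem stairNext_lt (α : Composition n) (k : Fin n) : stairNext α.blocks 0 k < n := by
  have := (stairNext_bounds (fun p hp => α.blocks_pos hp) (Nat.zero_le k)
    (by simp [α.blocks_sum])).2
  simpa [α.blocks_sum] using this

/-- The entries of the `i`-th cycle of the element in stair form. -/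
def stairBlock (α : Composition n) (i : Fin α.length) : List (Fin n) :=
  List.ofFn fun j : Fin (α.blocksFun i) => stairSeq n (α.embedding i j)

theorem stairCycle_eq (α : Composition n) (i : Fin α.length) :
    stairCycle α i = (stairBlock α i).formPerm := rfl

theorem nodup_stairBlock (α : Composition n) (i : Fin α.length) : (stairBlock α i).Nodup :=
  List.nodup_ofFn.2 ((stairSeq_injective n).comp (α.embedding i).injective)

theorem stairSeq_mem_stairBlock {α : Composition n} {i : Fin α.length} {k : Fin n} :
    stairSeq n k ∈ stairBlock α i ↔ i = α.index k := by
  rw [← α.mem_range_embedding_iff', stairBlock, List.mem_ofFn]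
  simp [(stairSeq_injective n).eq_iff, eq_comm]

theorem stairCycle_apply_of_ne {α : Composition n} {i : Fin α.length} {k : Fin n}
    (h : i ≠ α.index k) : stairCycle α i (stairSeq n k) = stairSeq n k :=
  List.formPerm_apply_of_notMem fun h' => h (stairSeq_mem_stairBlock.1 h')

theorem pairwise_disjoint_stairCycle (α : Composition n) :
    (List.ofFn fun i : Fin α.length => stairCycle α i).Pairwise Perm.Disjoint := by
  rw [List.pairwise_ofFn]
  intro i j hij x
  obtain ⟨k, rfl⟩ := stairSeq_surjective n x
  by_cases hi : i = α.index k
  · exact Or.inr (stairCycle_apply_of_ne fun hj => hij.ne (hi.trans hj.symm))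
  · exact Or.inl (stairCycle_apply_of_ne hi)

theorem list_prod_apply_of_forall {ι : Type*} {l : List (Perm ι)} {x : ι}
    (h : ∀ f ∈ l, f x = x) : l.prod x = x := by
  induction l with
  | nil => rfl
  | cons f l ih =>
    rw [List.prod_cons, Perm.mul_apply, ih fun g hg => h g (by simp [hg]), h f (by simp)]

theorem stairForm_apply_eq_stairCycle (α : Composition n) (k : Fin n) :
    stairForm α (stairSeq n k) = stairCycle α (α.index k) (stairSeq n k) := by
  by_cases h : stairCycle α (α.index k) (stairSeq n k) = stairSeq n k
  · rw [h]
    refine list_prod_apply_of_forall fun f hf => ?_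
    obtain ⟨i, rfl⟩ := List.mem_ofFn.1 hf
    by_cases hi : i = α.index k
    · rw [hi, h]
    · exact stairCycle_apply_of_ne hi
  · exact (Perm.eq_on_support_mem_disjoint (List.mem_ofFn.2 ⟨_, rfl⟩)
      (pairwise_disjoint_stairCycle α) _ (Perm.mem_support.2 h)).symm

theorem stairCycle_apply (α : Composition n) (i : Fin α.length) (j : Fin (α.blocksFun i)) :
    stairCycle α i (stairSeq n (α.embedding i j)) =
      stairSeq n (α.embedding i ⟨(j + 1) % α.blocksFun i, Nat.mod_lt _ (α.blocks_pos' _ i.2)⟩) := by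
  have := List.formPerm_apply_getElem _ (nodup_stairBlock α i) j (by simp [stairBlock])
  simpa [stairBlock, stairCycle] using this

theorem stairForm_apply (α : Composition n) (k : Fin n) :
    stairForm α (stairSeq n k) = stairSeq n ⟨stairNext α.blocks 0 k, stairNext_lt α k⟩ := by
  have h1 := stairForm_apply_eq_stairCycle α k
  have h2 := stairCycle_apply α (α.index k) (α.invEmbedding k)
  rw [α.embedding_comp_inv] at h2
  rw [h1, h2]
  congr 1
  have h3 := stairNext_getElem (L := α.blocks) (b := 0) (α.index k).2 (α.invEmbedding k).2
  have h4 := α.sizeUpTo_index_le k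
  simp only [Composition.sizeUpTo] at h4
  simp only [zero_add, Composition.coe_invEmbedding, Composition.sizeUpTo,
    Nat.add_sub_cancel' h4] at h3
  exact Fin.ext h3.symm

/-! ### Conjugacy of elements in stair form -/

theorem cycleType_list_prod {ι : Type*} [Fintype ι] [DecidableEq ι] {l : List (Perm ι)}
    (h : l.Pairwise Perm.Disjoint) : l.prod.cycleType = (l.map Perm.cycleType).sum := by
  induction l with
  | nil => simp
  | cons f l ih =>
    rw [List.pairwise_cons] at h
    rw [List.prod_cons, (Perm.disjoint_prod_right l h.1).cycleType_mul, ih h.2, List.map_cons,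
      List.sum_cons]

theorem cycleType_stairForm (α : Composition n) :
    (stairForm α).cycleType = (α.blocks.filter (2 ≤ ·) : Multiset ℕ) := by
  have h1 : ∀ i, (stairCycle α i).cycleType =
      if 2 ≤ α.blocksFun i then {α.blocksFun i} else 0 := by
    intro i
    have hlen : (stairBlock α i).length = α.blocksFun i := by simp [stairBlock]
    rw [stairCycle_eq]
    split_ifs with h
    · rw [(List.isCycle_formPerm (nodup_stairBlock α i) (hlen.ge.trans' h)).cycleType,
        List.support_formPerm_of_nodup _ (nodup_stairBlock α i)
          (fun x hx => by rw [hx] at hlen; simp at hlen; omega),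
        List.toFinset_card_of_nodup (nodup_stairBlock α i), hlen]
    · rw [Perm.cycleType_eq_zero, List.formPerm_eq_one_iff _ (nodup_stairBlock α i)]
      omega
  have h2 : ∀ l : List ℕ, (l.map fun p => if 2 ≤ p then ({p} : Multiset ℕ) else 0).sum =
      (l.filter (2 ≤ ·) : Multiset ℕ) := by
    intro l
    induction l with
    | nil => rfl
    | cons p l ih =>
      rw [List.map_cons, List.sum_cons, ih, List.filter_cons]
      by_cases h : 2 ≤ p
      · simp [h]
      · simp only [h, if_false, zero_add, decide_false, Bool.false_eq_true]
  rw [stairForm, cycleType_list_prod (pairwise_disjoint_stairCycle α), ← h2, ← α.ofFn_blocksFun,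
    List.map_ofFn, List.map_ofFn]
  congr 2
  funext i
  exact h1 i

theorem filter_two_le_eq_replicate {L : List ℕ} (hL : ∀ p ∈ L, 0 < p) :
    L.filter (fun p => !decide (2 ≤ p)) =
      List.replicate (L.filter (fun p => !decide (2 ≤ p))).length 1 := by
  rw [List.eq_replicate_iff]
  refine ⟨rfl, fun p hp => ?_⟩
  rw [List.mem_filter] at hp
  have h1 := hL p hp.1
  have h2 : ¬ 2 ≤ p := by simpa using hp.2
  omega

/-- A list of positive numbers is determined, up to order, by its entries greater than one and its
sum. -/
theorem perm_of_filter_two_le {L L' : List ℕ} (hL : ∀ p ∈ L, 0 < p) (hL' : ∀ p ∈ L', 0 < p)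
    (hsum : L.sum = L'.sum) (h : (L.filter (2 ≤ ·)).Perm (L'.filter (2 ≤ ·))) : L.Perm L' := by
  have h1 := List.filter_append_perm (fun p => decide (2 ≤ p)) L
  have h2 := List.filter_append_perm (fun p => decide (2 ≤ p)) L'
  rw [filter_two_le_eq_replicate hL] at h1
  rw [filter_two_le_eq_replicate hL'] at h2
  have e1 := h1.sum_eq
  have e2 := h2.sum_eq
  have e3 := h.sum_eq
  simp only [List.sum_append, List.sum_replicate, smul_eq_mul, mul_one] at e1 e2
  refine h1.symm.trans (List.Perm.trans ?_ h2)
  rw [show (L.filter (fun p => !decide (2 ≤ p))).length =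
    (L'.filter (fun p => !decide (2 ≤ p))).length by omega]
  exact h.append_right _

theorem isConj_stairForm_iff (α β : Composition n) :
    IsConj (stairForm α) (stairForm β) ↔ α.blocks.Perm β.blocks := by
  rw [Perm.isConj_iff_cycleType_eq, cycleType_stairForm, cycleType_stairForm, Multiset.coe_eq_coe]
  exact ⟨perm_of_filter_two_le (fun _ h => α.blocks_pos h) (fun _ h => β.blocks_pos h)
    (α.blocks_sum.trans β.blocks_sum.symm), fun h => h.filter _⟩

/-! ### The length of an element in stair form -/

/-- Inversions may be counted after relabelling the positions: an unordered pair is an inversion if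
`w` reverses the order of its two members. -/
theorem card_inversions_relabel {x : Fin n → Fin n} (hx : Function.Injective x)
    (w : Perm (Fin n)) :
    (Finset.univ.filter fun p : Fin n × Fin n =>
      p.1 < p.2 ∧ (x p.1 < x p.2 ↔ w (x p.2) < w (x p.1))).card = (inversions w).card := by
  refine Finset.card_bij
    (fun p _ => if x p.1 < x p.2 then (x p.1, x p.2) else (x p.2, x p.1)) ?_ ?_ ?_
  · rintro ⟨k, l⟩ hp
    simp only [Finset.mem_filter, Finset.mem_univ, true_and] at hp
    obtain ⟨hkl, h⟩ := hp
    dsimp only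
    split_ifs with hlt
    · exact mem_inversions.2 ⟨hlt, h.1 hlt⟩
    · refine mem_inversions.2 ⟨lt_of_le_of_ne (not_lt.1 hlt) (hx.ne hkl.ne'), ?_⟩
      exact lt_of_le_of_ne (not_lt.1 fun h' => hlt (h.2 h')) ((w.injective.comp hx).ne hkl.ne)
  · rintro ⟨k, l⟩ hp ⟨k', l'⟩ hp' he
    simp only [Finset.mem_filter, Finset.mem_univ, true_and] at hp hp'
    dsimp only at he
    split_ifs at he <;> simp only [Prod.mk.injEq, hx.eq_iff] at he ⊢
    · exact he
    · exact absurd hp.1 (by rw [he.1, he.2]; exact hp'.1.not_gt)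
    · exact absurd hp.1 (by rw [he.1, he.2]; exact hp'.1.not_gt)
    · exact he.symm
  · rintro ⟨a, b⟩ hab
    obtain ⟨h1, h2⟩ := mem_inversions.1 hab
    obtain ⟨k, rfl⟩ := Finite.surjective_of_injective hx a
    obtain ⟨l, rfl⟩ := Finite.surjective_of_injective hx b
    rcases lt_trichotomy k l with h | rfl | h
    · exact ⟨(k, l), by simp [h, h1, h2], by simp [h1]⟩
    · exact absurd h1 (lt_irrefl _)
    · exact ⟨(l, k), by simp [h, h1.not_gt, h2.not_gt], by simp [h1.not_gt]⟩

theorem card_keepsOrder (L : List ℕ) (hL : ∀ p ∈ L, 0 < p) (hn : L.sum = n) :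
    (Finset.univ.filter fun p : Fin n × Fin n => p.1 < p.2 ∧ KeepsOrder L 0 p.1 p.2).card =
      (L.map fun p => (p - 1) / 2).sum + oddCost L := by
  rw [← sum_keepsOrder hL 0, hn, zero_add, Finset.card_filter, Fintype.sum_prod_type,
    ← Finset.range_eq_Ico]
  simp only [Fin.lt_def]
  rw [Fin.sum_univ_eq_sum_range
    (fun k => ∑ l : Fin n, if k < (l : ℕ) ∧ KeepsOrder L 0 k l then 1 else 0) n]
  refine Finset.sum_congr rfl fun k _ => ?_
  rw [Fin.sum_univ_eq_sum_range (fun l => if k < l ∧ KeepsOrder L 0 k l then 1 else 0) n,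
    ← Finset.sum_filter, ← Finset.sum_filter]
  refine Finset.sum_congr ?_ fun _ _ => rfl
  ext l
  simp only [Finset.mem_filter, Finset.mem_range, Finset.mem_Ico, Nat.add_one_le_iff]
  tauto

/-- The number of inversions of an element in stair form, as the complement of the number of its
non-inversions. -/
theorem card_inversions_stairForm_add (α : Composition n) :
    (inversions (stairForm α)).card +
        ((α.blocks.map fun p => (p - 1) / 2).sum + oddCost α.blocks) =
      (Finset.univ.filter fun p : Fin n × Fin n => p.1 < p.2).card := by
  rw [← card_inversions_relabel (stairSeq_injective n),
    ← card_keepsOrder _ (fun _ h => α.blocks_pos h) α.blocks_sum, Finset.card_filter,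
    Finset.card_filter, Finset.card_filter, ← Finset.sum_add_distrib]
  refine Finset.sum_congr rfl fun ⟨k, l⟩ _ => ?_
  dsimp only
  by_cases hkl : k < l
  · have h1 : stairSeq n k < stairSeq n l ↔ (k : ℕ) % 2 = 0 := by
      rw [stairSeq_lt_iff, StairLt]
      omega
    have h2 : stairForm α (stairSeq n l) < stairForm α (stairSeq n k) ↔
        ¬ StairLt (stairNext α.blocks 0 k) (stairNext α.blocks 0 l) := by
      have h3 : stairForm α (stairSeq n k) ≠ stairForm α (stairSeq n l) :=
        ((stairForm α).injective.comp (stairSeq_injective n)).ne hkl.ne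
      rw [← h3.symm.le_iff_lt, ← not_lt, stairForm_apply, stairForm_apply, stairSeq_lt_iff]
    simp only [h1, h2, hkl, true_and, if_true, KeepsOrder]
    split_ifs <;> first | rfl | (exfalso; tauto)
  · simp [hkl]

/-- An element in stair form whose composition is maximal is at least as long as every other
rearrangement of its blocks. -/
theorem coxeterLength_stairForm_le {α β : Composition n} (hα : IsMaximalComposition α)
    (h : α.blocks.Perm β.blocks) : coxeterLength (stairForm β) ≤ coxeterLength (stairForm α) := by
  have h1 := card_inversions_stairForm_add α
  have h2 := card_inversions_stairForm_add β
  have h3 := (oddCost_le_minCost_iff fun _ h => α.blocks_pos h).2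
    ((isMaximalComposition_iff α).1 hα)
  have h4 := minCost_le_oddCost β.blocks
  rw [coxeterLength_eq, coxeterLength_eq]
  rw [(h.map fun p => (p - 1) / 2).sum_eq] at h1
  rw [minCost_perm h] at h3
  omega

/-- Only maximal compositions give elements in stair form of the greatest possible length. -/
theorem isMaximalComposition_of_coxeterLength_le {α β : Composition n}
    (hα : IsMaximalComposition α) (h : α.blocks.Perm β.blocks)
    (hle : coxeterLength (stairForm α) ≤ coxeterLength (stairForm β)) :
    IsMaximalComposition β := by
  rw [isMaximalComposition_iff, ← oddCost_le_minCost_iff fun _ h => β.blocks_pos h]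
  have h1 := card_inversions_stairForm_add α
  have h2 := card_inversions_stairForm_add β
  have h3 := (oddCost_le_minCost_iff fun _ h => α.blocks_pos h).2
    ((isMaximalComposition_iff α).1 hα)
  rw [coxeterLength_eq, coxeterLength_eq] at hle
  rw [(h.map fun p => (p - 1) / 2).sum_eq] at h1
  rw [minCost_perm h] at h3
  omega

/-! ### Cyclic shifts to stair form -/

theorem coxeterLength_le_swap_conj {i j : Fin n} (hij : (j : ℕ) = i + 1) {w : Perm (Fin n)}
    (h : w⁻¹ i < w⁻¹ j) : coxeterLength w ≤ coxeterLength (swap i j * w * swap i j) := by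
  rw [coxeterLength_eq, coxeterLength_eq]
  have h1 := card_inversions_swap_mul hij h
  have h2 := card_inversions_mul_swap_le hij (swap i j * w)
  omega

theorem cyclicShiftStep_swap_conj {i j : Fin n} (hij : (j : ℕ) = i + 1) {w : Perm (Fin n)}
    (h : w⁻¹ i < w⁻¹ j) : CyclicShiftStep (swap i j * w * swap i j) w :=
  ⟨swap i j, swap_mem_adjacentTranspositions hij, by simp [mul_assoc],
    coxeterLength_le_swap_conj hij h⟩

/-- If `w` sends the first positions of the stair sequence to positions up to `k`, then the image
`x_m` of `x_k` can be moved by one towards the end of the interval `{x_(k+1), x_(k+2), …}` that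
`x_k` faces, without decreasing the length. -/
theorem exists_cyclicShift_image_closer {w : Perm (Fin n)} {k m t : Fin n}
    (ht : (t : ℕ) = k + 1) (hkm : k < m) (hmt : m ≠ t) (hw : w (stairSeq n k) = stairSeq n m)
    (hlow : ∀ j < k, ∃ j' ≤ k, w (stairSeq n j) = stairSeq n j') :
    ∃ (w' : Perm (Fin n)) (m' : Fin n), CyclicShiftStep w' w ∧
      (∀ j < k, w' (stairSeq n j) = w (stairSeq n j)) ∧ w' (stairSeq n k) = stairSeq n m' ∧
      k < m' ∧ Nat.dist (stairSeq n m') (stairSeq n t) < Nat.dist (stairSeq n m) (stairSeq n t) := by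
  -- `x_t` is the largest remaining entry for even `k`, the smallest one for odd `k`.
  have hmt' : (k : ℕ) % 2 = 0 → stairSeq n m < stairSeq n t := fun hk => by
    rw [stairSeq_lt_iff, StairLt]; omega
  have htm' : (k : ℕ) % 2 = 1 → stairSeq n t < stairSeq n m := fun hk => by
    rw [stairSeq_lt_iff, StairLt]; omega
  obtain ⟨m', hm'⟩ : ∃ m' : Fin n, (stairSeq n m' : ℕ) =
      if (k : ℕ) % 2 = 0 then (stairSeq n m : ℕ) + 1 else stairSeq n m - 1 := by
    have h1 := (stairSeq n t).2
    have h2 := (stairSeq n m).2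
    rw [Fin.lt_def] at hmt' htm'
    obtain ⟨m', hm'⟩ := stairSeq_surjective n
      ⟨if (k : ℕ) % 2 = 0 then (stairSeq n m : ℕ) + 1 else stairSeq n m - 1,
        by split_ifs <;> omega⟩
    exact ⟨m', by rw [hm']⟩
  have hkm' : k < m' := by
    by_contra hle
    have h1 := stairSeq_lt_iff m m'
    have h2 := stairSeq_lt_iff m' m
    have h3 := stairSeq_lt_iff t m'
    have h4 := stairSeq_lt_iff m' t
    simp only [Fin.lt_def, StairLt] at *
    split_ifs at hm' <;> omega
  have hne : stairSeq n m ≠ stairSeq n m' := by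
    intro h
    rw [h] at hm' hmt' htm'
    simp only [Fin.lt_def] at *
    split_ifs at hm' <;> omega
  have hfix : ∀ j ≤ k, swap (stairSeq n m) (stairSeq n m') (stairSeq n j) = stairSeq n j :=
    fun j hj => swap_apply_of_ne_of_ne ((stairSeq_injective n).ne (hj.trans_lt hkm).ne)
      ((stairSeq_injective n).ne (hj.trans_lt hkm').ne)
  -- The entry next to `x_m` has its preimage among the remaining entries.
  obtain ⟨i, hi⟩ := stairSeq_surjective n (w⁻¹ (stairSeq n m'))
  have hi' : w (stairSeq n i) = stairSeq n m' := by rw [hi]; simp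
  have hki : k < i := by
    rcases lt_trichotomy k i with h | h | h
    · exact h
    · exact absurd (by rw [← hw, h, hi']) hne
    · obtain ⟨j', hj', he⟩ := hlow i h
      exact absurd (stairSeq_injective n (he.symm.trans hi')) (hj'.trans_lt hkm').ne
  have hwk : w⁻¹ (stairSeq n m) = stairSeq n k := by rw [← hw]; simp
  have hlt := stairSeq_lt_iff k i
  have hlt' := stairSeq_lt_iff i k
  refine ⟨swap (stairSeq n m) (stairSeq n m') * w * swap (stairSeq n m) (stairSeq n m'), m', ?_,
    fun j hj => ?_, ?_, hkm', ?_⟩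
  · rcases Nat.mod_two_eq_zero_or_one k with hk | hk
    · refine cyclicShiftStep_swap_conj (by rw [hm', if_pos hk]) ?_
      rw [hwk, ← hi, hlt, StairLt]
      omega
    · rw [swap_comm]
      have := htm' hk
      rw [Fin.lt_def] at this
      refine cyclicShiftStep_swap_conj (by rw [hm', if_neg (by omega)]; omega) ?_
      rw [hwk, ← hi, hlt', StairLt]
      omega
  · obtain ⟨j', hj', he⟩ := hlow j hj
    rw [Perm.mul_apply, Perm.mul_apply, hfix j hj.le, he, hfix j' hj']
  · rw [Perm.mul_apply, Perm.mul_apply, hfix k le_rfl, hw, swap_apply_left]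
  · simp only [Fin.lt_def, Nat.dist] at *
    split_ifs at hm' <;> omega

theorem exists_cyclicShift_image_eq {w : Perm (Fin n)} {k m t : Fin n}
    (ht : (t : ℕ) = k + 1) (hkm : k < m) (hw : w (stairSeq n k) = stairSeq n m)
    (hlow : ∀ j < k, ∃ j' ≤ k, w (stairSeq n j) = stairSeq n j') :
    ∃ w' : Perm (Fin n), CyclicShift w' w ∧
      (∀ j < k, w' (stairSeq n j) = w (stairSeq n j)) ∧ w' (stairSeq n k) = stairSeq n t := by
  induction hd : Nat.dist (stairSeq n m) (stairSeq n t) using Nat.strong_induction_on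
    generalizing w m with
  | _ d ih =>
    by_cases hmt : m = t
    · exact ⟨w, Relation.ReflTransGen.refl, fun _ _ => rfl, by rw [hw, hmt]⟩
    · obtain ⟨w₁, m₁, h1, h2, h3, h4, h5⟩ := exists_cyclicShift_image_closer ht hkm hmt hw hlow
      obtain ⟨w₂, h6, h7, h8⟩ := ih _ (hd ▸ h5) h4 h3
        (fun j hj => by rw [h2 j hj]; exact hlow j hj) rfl
      exact ⟨w₂, h6.tail h1, fun j hj => (h7 j hj).trans (h2 j hj), h8⟩

/-- The position to which the `j`-th entry is sent when the blocks of lengths `L` are closed and the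
next block is still open. -/
def openNext (L : List ℕ) (j : ℕ) : ℕ := if j < L.sum then stairNext L 0 j else j + 1

/-- `w` agrees with an element in stair form on the first `k` entries of the stair sequence, the
blocks with lengths `L` being closed. -/
def AgreesWithStair (w : Perm (Fin n)) (L : List ℕ) (k : ℕ) : Prop :=
  (∀ p ∈ L, 0 < p) ∧ L.sum ≤ k ∧
    ∀ j : Fin n, (j : ℕ) < k →
      ∃ j' : Fin n, (j' : ℕ) = openNext L j ∧ w (stairSeq n j) = stairSeq n j'

theorem exists_stairNext_eq {L : List ℕ} (hL : ∀ p ∈ L, 0 < p) {b m : ℕ} (h1 : b ≤ m)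
    (h2 : m < b + L.sum) : ∃ k, b ≤ k ∧ k < b + L.sum ∧ stairNext L b k = m := by
  induction L generalizing b with
  | nil => simp at h2; omega
  | cons p L ih =>
    have hp := hL p (by simp)
    simp only [List.sum_cons] at h2 ⊢
    rcases h1.eq_or_lt with rfl | h1
    · exact ⟨b + p - 1, by omega, by omega, stairNext_cons_of_eq L (by omega)⟩
    · rcases Nat.lt_or_ge m (b + p) with h | h
      · refine ⟨m - 1, by omega, by omega, ?_⟩
        rw [stairNext_cons_of_lt L (by omega)]
        omega
      · obtain ⟨k, h3, h4, h5⟩ := ih (fun q hq => hL q (by simp [hq])) h (by omega)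
        exact ⟨k, by omega, by omega, by rw [stairNext_cons_of_le L h3, h5]⟩

theorem exists_agreesWithStair_succ {w : Perm (Fin n)} {L : List ℕ} {k : ℕ} (hk : k < n)
    (h : AgreesWithStair w L k) :
    ∃ (w' : Perm (Fin n)) (L' : List ℕ), CyclicShift w' w ∧ AgreesWithStair w' L' (k + 1) := by
  obtain ⟨hL, hsum, hagree⟩ := h
  obtain ⟨m, hm⟩ := stairSeq_surjective n (w (stairSeq n ⟨k, hk⟩))
  have hinj : ∀ j : Fin n, w (stairSeq n j) = stairSeq n m → (j : ℕ) = k := fun j hj =>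
    congrArg Fin.val (stairSeq_injective n (w.injective (hj.trans hm)))
  -- The image of `x_k` is not one of the images of the previous entries.
  have hm_cases : (m : ℕ) = L.sum ∨ k < m := by
    rcases Nat.lt_trichotomy (m : ℕ) L.sum with h | h | h
    · obtain ⟨j, -, h2, h3⟩ := exists_stairNext_eq hL (Nat.zero_le m) (by rwa [zero_add])
      rw [zero_add] at h2
      obtain ⟨j', h4, h5⟩ := hagree ⟨j, by omega⟩ (by dsimp only; omega)
      rw [openNext, if_pos h2, h3] at h4
      rw [Fin.ext h4] at h5
      have := hinj _ h5
      dsimp only at this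
      omega
    · exact Or.inl h
    · right
      by_contra hle
      obtain ⟨j', h4, h5⟩ := hagree ⟨m - 1, by omega⟩ (by dsimp only; omega)
      rw [openNext, if_neg (by dsimp only; omega)] at h4
      have : j' = m := Fin.ext (by dsimp only at h4; omega)
      rw [this] at h5
      have := hinj _ h5
      dsimp only at this
      omega
  rcases hm_cases with hmb | hkm
  · -- The image is the first entry of the open block: this block gets closed.
    refine ⟨w, L ++ [k + 1 - L.sum], Relation.ReflTransGen.refl, ?_, ?_, fun j hj => ?_⟩
    · intro p hp
      rcases List.mem_append.1 hp with hp | hp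
      · exact hL p hp
      · rw [List.mem_singleton.1 hp]; omega
    · simp only [List.sum_append, List.sum_singleton]; omega
    · rw [openNext, if_pos (by simp only [List.sum_append, List.sum_singleton]; omega)]
      rcases Nat.lt_or_ge j L.sum with h | h
      · obtain ⟨j', h1, h2⟩ := hagree j (by omega)
        rw [openNext, if_pos h] at h1
        exact ⟨j', by rw [h1, stairNext_append_left _ (Nat.zero_le _) (by rwa [zero_add])], h2⟩
      · rw [stairNext_append_right _ (by rwa [zero_add])]
        rcases Nat.lt_or_ge j k with h' | h'
        · obtain ⟨j', h1, h2⟩ := hagree j h'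
          rw [openNext, if_neg (by omega)] at h1
          exact ⟨j', by rw [h1, stairNext_cons_of_lt _ (by omega)], h2⟩
        · refine ⟨m, by rw [stairNext_cons_of_eq _ (by omega)]; omega, ?_⟩
          rw [hm]
          congr 2
          exact Fin.ext (by dsimp only; omega)
  · have hlow : ∀ j < (⟨k, hk⟩ : Fin n), ∃ j' ≤ (⟨k, hk⟩ : Fin n),
        w (stairSeq n j) = stairSeq n j' := by
      intro j hj
      obtain ⟨j', h1, h2⟩ := hagree j hj
      refine ⟨j', ?_, h2⟩
      simp only [Fin.lt_def, Fin.le_def, openNext] at *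
      split_ifs at h1 with h
      · have := (stairNext_bounds hL (Nat.zero_le (j : ℕ)) (by rwa [zero_add])).2
        omega
      · omega
    obtain ⟨w', h1, h2, h3⟩ := exists_cyclicShift_image_eq (k := ⟨k, hk⟩)
      (t := ⟨k + 1, by omega⟩) rfl (by rwa [Fin.lt_def]) hm.symm hlow
    refine ⟨w', L, h1, hL, by omega, fun j hj => ?_⟩
    rcases Nat.lt_or_ge j k with h | h
    · rw [h2 j h]
      exact hagree j h
    · obtain rfl : j = ⟨k, hk⟩ := Fin.ext (by dsimp only; omega)
      exact ⟨_, by rw [openNext, if_neg (by dsimp only; omega)], h3⟩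

/-- Every permutation is obtained by cyclic shifts from an element in stair form. -/
theorem exists_cyclicShift_stairForm (w : Perm (Fin n)) :
    ∃ α : Composition n, CyclicShift (stairForm α) w := by
  have key : ∀ k ≤ n, ∃ (w' : Perm (Fin n)) (L : List ℕ),
      CyclicShift w' w ∧ AgreesWithStair w' L k := by
    intro k
    induction k with
    | zero =>
      exact fun _ => ⟨w, [], Relation.ReflTransGen.refl, by simp, le_rfl, fun j hj => by omega⟩
    | succ k ih =>
      intro hk
      obtain ⟨w₁, L, h1, h2⟩ := ih (by omega)
      obtain ⟨w₂, L', h3, h4⟩ := exists_agreesWithStair_succ hk h2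
      exact ⟨w₂, L', h3.trans h1, h4⟩
  obtain ⟨w', L, h1, hL, hsum, hagree⟩ := key n le_rfl
  have hn : L.sum = n := by
    -- No block can be open at the end: the last entry would have no successor.
    by_contra hne
    obtain ⟨j', h2, -⟩ := hagree ⟨n - 1, by omega⟩ (by dsimp only; omega)
    rw [openNext, if_neg (by dsimp only; omega)] at h2
    dsimp only at h2
    omega
  refine ⟨⟨L, fun h => hL _ h, hn⟩, ?_⟩
  convert h1
  ext x
  obtain ⟨j, rfl⟩ := stairSeq_surjective n x
  obtain ⟨j', h2, h3⟩ := hagree j j.2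
  rw [openNext, if_pos (by omega)] at h2
  rw [stairForm_apply, h3]
  congr 2
  exact Fin.ext h2.symm

/-! ### Invariance under length-preserving cyclic shifts -/

theorem CyclicShift.isConj {w w' : Perm (Fin n)} (h : CyclicShift w w') : IsConj w w' := by
  induction h with
  | refl => exact IsConj.refl w
  | tail _ h ih =>
    obtain ⟨s, hs, rfl, -⟩ := h
    obtain ⟨i, j, -, rfl⟩ := exists_eq_swap hs
    exact ih.trans (isConj_iff.2 ⟨swap i j, by rw [swap_inv]⟩)

theorem CyclicShift.coxeterLength_le {w w' : Perm (Fin n)} (h : CyclicShift w w') :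
    coxeterLength w' ≤ coxeterLength w := by
  induction h with
  | refl => exact le_rfl
  | tail _ h ih =>
    obtain ⟨s, -, -, hle⟩ := h
    exact hle.trans ih

theorem CyclicShift.symm_of_coxeterLength_le {w w' : Perm (Fin n)} (h : CyclicShift w w')
    (hle : coxeterLength w ≤ coxeterLength w') : CyclicShift w' w := by
  induction h with
  | refl => exact Relation.ReflTransGen.refl
  | tail h₁ h ih =>
    obtain ⟨s, hs, rfl, hle'⟩ := h
    refine Relation.ReflTransGen.head ⟨s, hs, ?_, (CyclicShift.coxeterLength_le h₁).trans hle⟩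
      (ih (hle.trans hle'))
    obtain ⟨i, j, -, rfl⟩ := exists_eq_swap hs
    simp [mul_assoc]

/-- If `w` has a descent at `(i, j)` on both sides, conjugation by this adjacent transposition
either shortens `w` or does not change it. -/
theorem swap_conj_eq_self {i j : Fin n} (hij : (j : ℕ) = i + 1) {w : Perm (Fin n)}
    (h : w j < w i) (h' : w⁻¹ j < w⁻¹ i)
    (hle : coxeterLength w ≤ coxeterLength (swap i j * w * swap i j)) :
    swap i j * w * swap i j = w := by
  rw [coxeterLength_eq, coxeterLength_eq, mul_assoc] at hle
  have h1 := card_inversions_mul_swap_of_gt hij h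
  have hne : i ≠ j := by rw [Ne, Fin.ext_iff]; omega
  have h2 : (w * swap i j)⁻¹ i < (w * swap i j)⁻¹ j := by
    by_contra hlt
    have h3 := card_inversions_mul_swap_of_gt hij (w := (w * swap i j)⁻¹)
      (lt_of_le_of_ne (not_lt.1 hlt) ((w * swap i j)⁻¹.injective.ne hne.symm))
    rw [card_inversions_inv, ← card_inversions_inv ((w * swap i j)⁻¹ * swap i j), mul_inv_rev,
      inv_inv, swap_inv] at h3
    omega
  rw [mul_inv_rev, swap_inv, Perm.mul_apply, Perm.mul_apply] at h2
  -- Only the pair `(i, j)` itself is reversed by the transposition.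
  have h3 : w⁻¹ i = j ∧ w⁻¹ j = i := by
    by_contra hc
    by_cases hc' : w⁻¹ i = i ∧ w⁻¹ j = j
    · rw [hc'.1, hc'.2, Fin.lt_def] at h'
      omega
    · rw [swap_lt_swap_iff hij hc' hc] at h2
      exact lt_asymm h' h2
  have h4 : w * swap i j = swap i j * w := by
    rw [Perm.inv_eq_iff_eq, Perm.inv_eq_iff_eq] at h3
    rw [mul_swap_eq_swap_mul, ← h3.1, ← h3.2, swap_comm]
  rw [mul_assoc, h4, ← mul_assoc, swap_mul_self, one_mul]

/-- `w` exchanges the set of the first `j` points with the set of the last `j` points. -/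
def SwapsEnds (w : Perm (Fin n)) (j : ℕ) : Prop :=
  ∀ a : Fin n, ((a : ℕ) < j ↔ n - j ≤ (w a : ℕ)) ∧ (n - j ≤ (a : ℕ) ↔ (w a : ℕ) < j)

theorem SwapsEnds.inv_apply {w : Perm (Fin n)} {j : ℕ} (h : SwapsEnds w j) (a : Fin n) :
    ((w⁻¹ a : ℕ) < j ↔ n - j ≤ (a : ℕ)) ∧ (n - j ≤ (w⁻¹ a : ℕ) ↔ (a : ℕ) < j) := by
  simpa using h (w⁻¹ a)

/-- A transposition which does not preserve one of the two exchanged sets is a descent of `w` on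
both sides, so it cannot change `w` without shortening it. -/
theorem SwapsEnds.swap_conj {i i' : Fin n} (hi : (i' : ℕ) = i + 1) {w : Perm (Fin n)} {j : ℕ}
    (hj : 2 * j ≤ n) (h : SwapsEnds w j)
    (hle : coxeterLength w ≤ coxeterLength (swap i i' * w * swap i i')) :
    SwapsEnds (swap i i' * w * swap i i') j := by
  by_cases hb : (i' : ℕ) = j ∨ (i' : ℕ) = n - j
  · rw [swap_conj_eq_self hi _ _ hle]
    · exact h
    · have h1 := h i
      have h2 := h i'
      rw [Fin.lt_def]
      omega
    · have h1 := h.inv_apply i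
      have h2 := h.inv_apply i'
      rw [Fin.lt_def]
      omega
  · have hs : ∀ a : Fin n, ((swap i i' a : ℕ) < j ↔ (a : ℕ) < j) ∧
        (n - j ≤ (swap i i' a : ℕ) ↔ n - j ≤ (a : ℕ)) := by
      intro a
      rw [swap_apply_def]
      split_ifs with h1 h2
      · rw [h1]; omega
      · rw [h2]; omega
      · simp
    intro a
    have h1 := hs (w (swap i i' a))
    have h2 := hs a
    have h3 := h (swap i i' a)
    rw [Perm.mul_apply, Perm.mul_apply, h1.1, h1.2, ← h3.1, ← h3.2, h2.1, h2.2]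
    exact ⟨Iff.rfl, Iff.rfl⟩

theorem SwapsEnds.cyclicShift {w w' : Perm (Fin n)} (h : CyclicShift w w') {j : ℕ}
    (hj : 2 * j ≤ n) (hw : SwapsEnds w j) (hle : coxeterLength w ≤ coxeterLength w') :
    SwapsEnds w' j := by
  induction h with
  | refl => exact hw
  | tail h₁ h ih =>
    obtain ⟨s, hs, rfl, hle'⟩ := h
    obtain ⟨i, i', hi, rfl⟩ := exists_eq_swap hs
    exact (ih (hle.trans hle')).swap_conj hi hj ((CyclicShift.coxeterLength_le h₁).trans hle)

theorem swapsEnds_iff_of_cyclicShiftEquiv {w w' : Perm (Fin n)} (h : CyclicShiftEquiv w w') {j : ℕ}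
    (hj : 2 * j ≤ n) : SwapsEnds w j ↔ SwapsEnds w' j :=
  ⟨fun hw => hw.cyclicShift h.1 hj (CyclicShift.coxeterLength_le h.2),
    fun hw => hw.cyclicShift h.2 hj (CyclicShift.coxeterLength_le h.1)⟩

theorem swapsEnds_stairForm_iff (α : Composition n) {j : ℕ} (hj : 2 * j ≤ n) :
    SwapsEnds (stairForm α) j ↔ FlipsParity α.blocks 0 (2 * j) := by
  -- The first `j` points are the `x_k` with `k < 2 * j` even, the last `j` those with `k` odd.
  have hval : ∀ k : Fin n, ((stairSeq n k : ℕ) < j ↔ (k : ℕ) < 2 * j ∧ (k : ℕ) % 2 = 0) ∧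
      (n - j ≤ (stairSeq n k : ℕ) ↔ (k : ℕ) < 2 * j ∧ (k : ℕ) % 2 = 1) := by
    intro k
    have := k.2
    rw [stairSeq]
    split_ifs <;> dsimp only <;> omega
  rw [SwapsEnds, (stairSeq_surjective n).forall]
  simp only [stairForm_apply, (hval _).1, (hval _).2, FlipsParity, α.blocks_sum, zero_add]
  constructor
  · intro h k _ hk
    have := h ⟨k, hk⟩
    dsimp only at this
    omega
  · intro h k
    have := h k (Nat.zero_le _) k.2
    omega

theorem eq_of_cyclicShiftEquiv_stairForm {α β : Composition n} (hα : IsMaximalComposition α)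
    (hβ : IsMaximalComposition β) (h : CyclicShiftEquiv (stairForm α) (stairForm β)) : α = β := by
  refine Composition.ext (eq_of_flipsParity_iff (fun _ h => α.blocks_pos h)
    ((isConj_stairForm_iff α β).1 (CyclicShift.isConj h.1)) ((isMaximalComposition_iff α).1 hα)
    ((isMaximalComposition_iff β).1 hβ) 0 fun m hm hle => ?_)
  rw [α.blocks_sum] at hle
  obtain ⟨j, rfl⟩ : ∃ j, m = 2 * j := ⟨m / 2, by omega⟩
  rw [← swapsEnds_stairForm_iff α hle, ← swapsEnds_stairForm_iff β hle,
    swapsEnds_iff_of_cyclicShiftEquiv h hle]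

/-! ### Representatives of the classes of maximal elements -/

theorem exists_isMaximalComposition_perm (β : Composition n) :
    ∃ α : Composition n, IsMaximalComposition α ∧ α.blocks.Perm β.blocks := by
  classical
  have : Std.Total StairOrder := ⟨fun p q => by
    simp only [StairOrder, Nat.even_iff, Nat.odd_iff]; omega⟩
  have : IsTrans ℕ StairOrder := ⟨fun p q r => by
    simp only [StairOrder, Nat.even_iff, Nat.odd_iff]; omega⟩
  have hp := β.blocks.perm_insertionSort StairOrder
  exact ⟨⟨β.blocks.insertionSort StairOrder, fun h => β.blocks_pos (hp.mem_iff.1 h),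
    hp.sum_eq.trans β.blocks_sum⟩, (isMaximalComposition_iff _).2
      (β.blocks.pairwise_insertionSort StairOrder), hp⟩

theorem stairForm_mem_maxLengthElements {α : Composition n} (hα : IsMaximalComposition α) :
    stairForm α ∈ maxLengthElements n := by
  intro w hw
  obtain ⟨β, hβ⟩ := exists_cyclicShift_stairForm w
  refine (CyclicShift.coxeterLength_le hβ).trans (coxeterLength_stairForm_le hα ?_)
  exact (isConj_stairForm_iff α β).1 (hw.trans (CyclicShift.isConj hβ).symm)

theorem exists_cyclicShiftEquiv_stairForm {w : Perm (Fin n)} (hw : w ∈ maxLengthElements n) :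
    ∃ α : Composition n, IsMaximalComposition α ∧ CyclicShiftEquiv (stairForm α) w := by
  obtain ⟨β, hβ⟩ := exists_cyclicShift_stairForm w
  have hle := hw _ (CyclicShift.isConj hβ).symm
  obtain ⟨α, hα, hperm⟩ := exists_isMaximalComposition_perm β
  refine ⟨β, isMaximalComposition_of_coxeterLength_le hα hperm ?_, hβ,
    CyclicShift.symm_of_coxeterLength_le hβ hle⟩
  exact (hw _ ((CyclicShift.isConj hβ).symm.trans ((isConj_stairForm_iff β α).2 hperm.symm))).trans
    (CyclicShift.coxeterLength_le hβ)

end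

/-- For maximal `α`, the element `stairForm α` lies in the set of maximal length elements; sending
`α` to its class is a bijection onto the cyclic shift classes of such elements; and every class
contains exactly one of the elements `stairForm α`. -/
theorem mainTheorem1 (n : ℕ) :
    ∃ h : ∀ α : {α : Composition n // IsMaximalComposition α},
        stairForm α.1 ∈ maxLengthElements n,
      Function.Bijective
        (fun α : {α : Composition n // IsMaximalComposition α} =>
          (Quotient.mk (maxSetoid n) ⟨stairForm α.1, h α⟩ : MaxCyclicShiftClasses n)) ∧
      ∀ C : MaxCyclicShiftClasses n, ∃! w : maxLengthElements n,
        (w : Equiv.Perm (Fin n)) ∈ {σ | ∃ α, IsMaximalComposition α ∧ σ = stairForm α} ∧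
          Quotient.mk (maxSetoid n) w = C := by
  have hsurj : ∀ w : maxLengthElements n, ∃ α : {α : Composition n // IsMaximalComposition α},
      Quotient.mk (maxSetoid n) ⟨stairForm α.1, stairForm_mem_maxLengthElements α.2⟩ =
        Quotient.mk (maxSetoid n) w := by
    intro w
    obtain ⟨α, hα, h⟩ := exists_cyclicShiftEquiv_stairForm w.2
    exact ⟨⟨α, hα⟩, Quotient.sound h⟩
  refine ⟨fun α => stairForm_mem_maxLengthElements α.2, ⟨fun α β h => ?_, fun C => ?_⟩, fun C => ?_⟩
  · exact Subtype.ext (eq_of_cyclicShiftEquiv_stairForm α.2 β.2 (Quotient.exact h))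
  · obtain ⟨w, rfl⟩ := Quotient.exists_rep C
    exact hsurj w
  · obtain ⟨w, rfl⟩ := Quotient.exists_rep C
    obtain ⟨α, hα⟩ := hsurj w
    refine ⟨⟨stairForm α.1, stairForm_mem_maxLengthElements α.2⟩, ⟨⟨α.1, α.2, rfl⟩, hα⟩, ?_⟩
    rintro ⟨_, _⟩ ⟨⟨β, hβ, rfl⟩, h⟩
    have := eq_of_cyclicShiftEquiv_stairForm hβ α.2 (Quotient.exact (h.trans hα.symm))
    exact Subtype.ext (congrArg stairForm this)
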